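/- Let $k$ be a field, let $n,d\ge 0$ be integers, let $S=k[x_0,\dots,x_n]$ with its standard grading, and let $R=S/\mathfrak p$, where $\mathfrak p$ is a homogeneous prime ideal of $S$. Let $M_1,\dots,M_N$, $N=\binom{n+d}{d}$, be the monomials of degree $d$ in $S$, and for $\mathbf a=(a_1,\dots,a_N)\in k^N$ put $f_{\mathbf a}=\sum_{i=1}^N a_iM_i$. Let $\mathbb P^{2N-1}_k$ denote the set of points with homogeneous coordinates in $k$, i.e. of nonzero vectors $(\mathbf a,\mathbf b)\in k^N\times k^N$ up to a common scalar in $k^\times$; a subset is Zariski open if its complement is the common zero set of a set of homogeneous polynomials over $k$ in the $2N$ coordinates. Let $$G_2=\{(\mathbf a,\mathbf b)\in\mathbb P^{2N-1}_k : f_{\mathbf a},f_{\mathbf b}\text{ is a regular sequence in }R\}.$$ Then: 1. $G_2$ is a Zariski open subset of $\mathbb P^{2N-1}_k$. 2. If $G_2$ is non-empty, then $\operatorname{depth} R\ge 2$. 3. If $k$ is infinite, $d\ge 1$ and $\operatorname{depth} R\ge 2$, then $G_2$ is non-empty. In particular, if $k$ is infinite and $d\ge 1$, then $G_2\neq\emptyset$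 if and only if $\operatorname{depth} R\ge 2$. Here a regular sequence $g_1,\dots,g_s$ in $R$ is required to satisfy $(g_1,\dots,g_s)\ne R$, and $\operatorname{depth} R$ is the supremum of the lengths of the regular sequences in $R$ that are contained in the ideal generated by the classes of $x_0,\dots,x_n$. -/

import Mathlib

namespace OpenLoci

open MvPolynomial RingTheory.Sequence
open scoped LinearAlgebra.Projectivization

/-- The (exponent vectors of the) monomials of degree `d` in `x_0, …, x_n`. -/
abbrev Mon (n d : ℕ) : Type :=
  { m : Fin (n + 1) →₀ ℕ // m ∈ Finset.finsuppAntidiag (Finset.univ : Finset (Fin (n + 1))) d }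

/-- There are `N = (n + d).choose d` monomials of degree `d` in `n + 1` variables. -/
theorem card_mon (n d : ℕ) : Fintype.card (Mon n d) = (n + d).choose d := by
  rw [Fintype.card_coe, Finset.card_finsuppAntidiag_nat_eq_choose]
  simp [add_comm, add_left_comm]

variable {k : Type*} [Field k]

/-- The form `f_a = ∑ᵢ aᵢ Mᵢ` of degree `d` with coefficient vector `a`. -/
noncomputable def form {n d : ℕ} (a : Mon n d → k) : MvPolynomial (Fin (n + 1)) k :=
  ∑ i, a i • monomial i.1 (1 : k)

theorem form_smul {n d : ℕ} (c : k) (a : Mon n d → k) : form (c • a) = c • form a := by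
  simp [form, Finset.smul_sum, mul_smul]

/-- The coordinate space `k^{2N}`: the vectors `(a, b)` with `a, b ∈ k^N`,
`a = v (0, ·)` and `b = v (1, ·)`. Its projectivization is `ℙ^{2N-1}_k`. -/
abbrev PairCoord (k : Type*) (n d : ℕ) : Type _ := Fin 2 × Mon n d → k

/-- A set `U` of `k`-points of the projective space with homogeneous coordinates indexed by `ι`
is Zariski open: its complement is the common zero locus of a set of homogeneous polynomials
over `k` in the coordinates. -/
def IsZariskiOpen {ι : Type*} (U : Set (ℙ k (ι → k))) : Prop :=
  ∃ T : Set (MvPolynomial ι k), (∀ P ∈ T, ∃ e : ℕ, P.IsHomogeneous e) ∧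
    Uᶜ = { x | ∀ P ∈ T, eval x.rep P = 0 }

/-- Vanishing of a homogeneous polynomial at a point does not depend on the representative. -/
theorem eval_rep_mk {ι : Type*} {P : MvPolynomial ι k} {e : ℕ} (hP : P.IsHomogeneous e)
    (v : ι → k) (hv : v ≠ 0) :
    eval (Projectivization.mk k v hv).rep P = 0 ↔ eval v P = 0 := by
  obtain ⟨c, hc⟩ := Projectivization.exists_smul_eq_mk_rep k v hv
  rw [← hc, Units.smul_def]
  have h : eval ((c : k) • v) P = (c : k) ^ e * eval v P := by
    rw [eval_eq, eval_eq, Finset.mul_sum]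
    refine Finset.sum_congr rfl fun m hm => ?_
    have hdeg := hP (mem_support_iff.mp hm)
    rw [Finsupp.weight_apply, Finsupp.sum] at hdeg
    simp only [Pi.one_apply, smul_eq_mul, mul_one] at hdeg
    simp only [Pi.smul_apply, smul_eq_mul, mul_pow, Finset.prod_mul_distrib,
      Finset.prod_pow_eq_pow_sum, hdeg]
    ring
  simp [h]

/-- `f_a, f_b` (in this order) is a regular sequence in `R = k[x_0, …, x_n] / 𝔭`, where
`v = (a, b)`. -/
def IsRegularPair {n d : ℕ} (𝔭 : Ideal (MvPolynomial (Fin (n + 1)) k)) (v : PairCoord k n d) :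
    Prop :=
  IsRegular (MvPolynomial (Fin (n + 1)) k ⧸ 𝔭)
    [Ideal.Quotient.mk 𝔭 (form fun i => v (0, i)), Ideal.Quotient.mk 𝔭 (form fun i => v (1, i))]

/-- The locus `G₂ ⊆ ℙ^{2N-1}_k` of the pairs `(a, b)` such that `f_a, f_b` is a regular sequence
in `R = k[x_0, …, x_n] / 𝔭`. -/
def regularLocus {n : ℕ} (𝔭 : Ideal (MvPolynomial (Fin (n + 1)) k)) (d : ℕ) :
    Set (ℙ k (PairCoord k n d)) :=
  { x | IsRegularPair 𝔭 x.rep }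

theorem isRegular_pair_units_mul {A : Type*} [CommRing A] (c : Aˣ) (f g : A)
    (h : IsRegular A [f, g]) : IsRegular A [c * f, c * g] := by
  have key : ∀ l : List A, Ideal.ofList (l.map fun r => (c : A) * r) = Ideal.ofList l := by
    intro l
    induction l with
    | nil => simp
    | cons a l ih =>
      rw [List.map_cons, Ideal.ofList_cons, Ideal.ofList_cons, ih,
        Ideal.span_singleton_mul_left_unit c.isUnit]
  have hmap : [c * f, c * g] = [f, g].map fun r => (c : A) * r := rfl
  rw [hmap]
  refine ⟨⟨fun i hi => ?_⟩, ?_⟩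
  · have hi' : i < [f, g].length := by simpa using hi
    rw [← List.map_take, key, List.getElem_map]
    exact IsSMulRegular.mul (c.isUnit.isSMulRegular _) (h.regular_mod_prev i hi')
  · rw [key]
    exact h.top_ne_smul

theorem isRegularPair_smul {n d : ℕ} (𝔭 : Ideal (MvPolynomial (Fin (n + 1)) k)) (c : kˣ)
    (v : PairCoord k n d) (h : IsRegularPair 𝔭 v) : IsRegularPair 𝔭 (c • v) := by
  have e : ∀ j : Fin 2, Ideal.Quotient.mk 𝔭 (form fun i => (c • v) (j, i)) =
      (Units.map (algebraMap k (MvPolynomial (Fin (n + 1)) k ⧸ 𝔭)).toMonoidHom c : _) *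
        Ideal.Quotient.mk 𝔭 (form fun i => v (j, i)) := by
    intro j
    have : (fun i => (c • v) (j, i)) = (c : k) • fun i => v (j, i) := rfl
    rw [this, form_smul, MvPolynomial.smul_eq_C_mul, map_mul]
    rfl
  unfold IsRegularPair
  rw [e, e]
  exact isRegular_pair_units_mul _ _ _ h

/-- Membership in `G₂` does not depend on the representative. -/
theorem mk_mem_regularLocus {n d : ℕ} (𝔭 : Ideal (MvPolynomial (Fin (n + 1)) k))
    (v : PairCoord k n d) (hv : v ≠ 0) :
    Projectivization.mk k v hv ∈ regularLocus 𝔭 d ↔ IsRegularPair 𝔭 v := by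
  obtain ⟨c, hc⟩ := Projectivization.exists_smul_eq_mk_rep k v hv
  change IsRegularPair 𝔭 (Projectivization.mk k v hv).rep ↔ _
  rw [← hc]
  refine ⟨fun h => ?_, isRegularPair_smul 𝔭 c v⟩
  have := isRegularPair_smul 𝔭 c⁻¹ _ h
  rwa [inv_smul_smul] at this

/-- The grade of an ideal: the supremum of the lengths of the regular sequences inside it. -/
noncomputable def grade {A : Type*} [CommRing A] (I : Ideal A) : ℕ∞ :=
  ⨆ (rs : List A) (_ : IsRegular A rs) (_ : ∀ r ∈ rs, r ∈ I), (rs.length : ℕ∞)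

/-- The homogeneous maximal ideal `(x_0, …, x_n)` of `R = k[x_0, …, x_n] / 𝔭`. -/
noncomputable def irrelevantIdeal {n : ℕ} (𝔭 : Ideal (MvPolynomial (Fin (n + 1)) k)) :
    Ideal (MvPolynomial (Fin (n + 1)) k ⧸ 𝔭) :=
  Ideal.span (Set.range fun i => Ideal.Quotient.mk 𝔭 (X i))

/-- The depth of the standard graded ring `R = k[x_0, …, x_n] / 𝔭`: the grade of its homogeneous
maximal ideal. -/
noncomputable def gradedDepth {n : ℕ} (𝔭 : Ideal (MvPolynomial (Fin (n + 1)) k)) : ℕ∞ :=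
  grade (irrelevantIdeal 𝔭)

end OpenLoci

attribute [local instance] MvPolynomial.gradedAlgebra

namespace OpenLoci

open MvPolynomial

/-! ### Rank of a set of polynomials through minors of coefficients. -/

section LinearAlgebra

variable {K V σ : Type*} [Field K] [AddCommGroup V] [Module K V]

/-! Openness. Let `F`, `G` be forms of degree `d > 0` with classes `f`, `g` in `R`. The Koszul
complex `R(-2d) → R(-d)² → R` turns regularity into a dimension count: the pair is regular iff, in
every degree `e`, the kernel of `(u, w) ↦ f u + g w` is no larger than `R_{e-2d}`, that is, iff `𝔭 +
(F, G)` has dimension at least `regularRank` in degree `e` (`isRegular_mk_pair_iff`). For a single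
`e` this says that some minor, homogeneous in the coefficients of the two forms, does not vanish
(`le_finrank_pairForms_iff`), which is an open condition.

Infinitely many degrees must be cut down to finitely many
(`exists_finset_forall_le_finrank_specializedForms`). This is noetherian induction on closed subsets
of the parameter space: on an irreducible one, the leading monomials of the generic ideal survive
specialization off a hypersurface, so there the Hilbert function of the ideal is at least the
generic one in all degrees at once. For `d = 0` the locus is empty, a nonzero constant being a unit.

Depth. A regular pair of forms of positive degree lies in the irrelevant ideal, so the depth is at
least 2. Conversely, if the depth is at least 2 and `f ≠ 0`, no associated prime of `R/(f)` contains
the irrelevant ideal (`not_le_of_mem_associatedPrimes`). Over an infinite field some form of degree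
`d` avoids these finitely many primes (`exists_form_notMem`) and is regular modulo `f`. -/

theorem exists_linearIndependent_of_le_finrank_span (X : Set V)
    [FiniteDimensional K (Submodule.span K X)] {r : ℕ}
    (hr : r ≤ Module.finrank K (Submodule.span K X)) :
    ∃ u : Fin r → V, (∀ i, u i ∈ X) ∧ LinearIndependent K u := by
  obtain ⟨b, hbX, hspan, hb⟩ := exists_linearIndependent K X
  have B := Module.Basis.span hb
  rw [Subtype.range_coe, hspan] at B
  have : Finite b := Module.Finite.finite_basis B
  have := Fintype.ofFinite b
  rw [Module.finrank_eq_card_basis B, ← Fintype.card_fin r] at hr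
  obtain ⟨f⟩ := Function.Embedding.nonempty_of_card_le hr
  exact ⟨fun i => f i, fun i => hbX (f i).2, hb.comp f f.injective⟩

/-- Linearly independent polynomials have a nonzero maximal minor of coefficients. -/
theorem exists_det_coeff_ne_zero {r : ℕ} {u : Fin r → MvPolynomial σ K}
    (hu : LinearIndependent K u) :
    ∃ m : Fin r → σ →₀ ℕ, (Matrix.of fun i j => coeff (m j) (u i)).det ≠ 0 := by
  classical
  let col : (σ →₀ ℕ) → Fin r → K := fun m i => coeff m (u i)
  have htop : Submodule.span K (Set.range col) = ⊤ := by
    -- A functional vanishing on all coefficient columns is a linear relation among the `u i`.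
    by_contra hne
    obtain ⟨f, hf, hle⟩ := Submodule.exists_le_ker_of_lt_top _ (lt_top_iff_ne_top.mpr hne)
    apply hf
    have hc : ∀ x, f x = ∑ i, x i * f (Pi.single i 1) := fun x => by
      rw [LinearMap.pi_apply_eq_sum_univ f x]
      refine Finset.sum_congr rfl fun i _ => ?_
      rw [smul_eq_mul]
      congr 2
      ext j
      simp [Pi.single_apply, eq_comm]
    have h0 : ∑ i, f (Pi.single i 1) • u i = 0 := by
      ext m
      have hm : f (col m) = 0 := hle (Submodule.subset_span ⟨m, rfl⟩)
      rw [hc] at hm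
      simpa [coeff_sum, mul_comm, col] using hm
    have h1 := Fintype.linearIndependent_iff.mp hu _ h0
    ext x
    simp [h1]
  have hfd : FiniteDimensional K (Submodule.span K (Set.range col)) := inferInstance
  obtain ⟨w, hw, hli⟩ := exists_linearIndependent_of_le_finrank_span (K := K) (Set.range col)
    (r := r) (by rw [htop]; simp)
  choose m hm using hw
  refine ⟨m, ?_⟩
  have : LinearIndependent K (Matrix.of fun i j => coeff (m j) (u i)).col := by
    have hw : (Matrix.of fun i j => coeff (m j) (u i)).col = w := by
      ext j i
      rw [← hm j]
      rfl
    exact hw ▸ hli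
  rw [Matrix.linearIndependent_cols_iff_isUnit, Matrix.isUnit_iff_isUnit_det] at this
  exact this.ne_zero

theorem linearIndependent_of_det_coeff_ne_zero {r : ℕ} {u : Fin r → MvPolynomial σ K}
    {m : Fin r → σ →₀ ℕ} (h : (Matrix.of fun i j => coeff (m j) (u i)).det ≠ 0) :
    LinearIndependent K u := by
  have hrow : LinearIndependent K (Matrix.of fun i j => coeff (m j) (u i)).row := by
    rw [Matrix.linearIndependent_rows_iff_isUnit, Matrix.isUnit_iff_isUnit_det]
    exact h.isUnit
  let L : MvPolynomial σ K →ₗ[K] Fin r → K := LinearMap.pi fun j => lcoeff K (m j)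
  exact LinearIndependent.of_comp L hrow

theorem card_le_finrank_span_of_linearIndependent {X : Set V}
    [FiniteDimensional K (Submodule.span K X)] {ι : Type*} [Fintype ι] {u : ι → V}
    (hu : LinearIndependent K u) (hX : ∀ i, u i ∈ Submodule.span K X) :
    Fintype.card ι ≤ Module.finrank K (Submodule.span K X) := by
  have : LinearIndependent K (fun i => (⟨u i, hX i⟩ : Submodule.span K X)) :=
    LinearIndependent.of_comp (Submodule.subtype _) hu
  exact this.fintype_card_le_finrank

/-- The rank of a set of polynomials is detected by the minors of its coefficients. -/
theorem le_finrank_span_iff_exists_det_ne_zero {X : Set (MvPolynomial σ K)}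
    [FiniteDimensional K (Submodule.span K X)] {r : ℕ} :
    r ≤ Module.finrank K (Submodule.span K X) ↔
      ∃ u : Fin r → MvPolynomial σ K, (∀ i, u i ∈ X) ∧ ∃ m : Fin r → σ →₀ ℕ,
        (Matrix.of fun i j => coeff (m j) (u i)).det ≠ 0 := by
  constructor
  · intro h
    obtain ⟨u, hu, hli⟩ := exists_linearIndependent_of_le_finrank_span X h
    exact ⟨u, hu, exists_det_coeff_ne_zero hli⟩
  · rintro ⟨u, hu, m, hm⟩
    simpa using card_le_finrank_span_of_linearIndependent
      (linearIndependent_of_det_coeff_ne_zero hm) fun i => Submodule.subset_span (hu i)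

end LinearAlgebra

/-! ### Leading monomials modulo a prime of the coefficient ring. -/

section LeadingExponents

variable {σ A : Type*} [LinearOrder σ] [Finite σ] [CommRing A]

/-- The exponents `m` of the leading monomials, modulo `J`, of the forms in the ideal `I`. -/
def leadingExponents (I : Ideal (MvPolynomial σ A)) (J : Ideal A) : Set (σ →₀ ℕ) :=
  {m | ∃ G ∈ I, G.IsHomogeneous m.degree ∧ coeff m G ∉ J ∧
    ∀ m', MonomialOrder.lex.toSyn m < MonomialOrder.lex.toSyn m' → coeff m' G ∈ J}

/-- Leading exponents modulo a prime specialize outside a hypersurface. -/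
theorem exists_leadingExponents_subset_map (I : Ideal (MvPolynomial σ A)) (J : Ideal A)
    [hJ : J.IsPrime] (K : Type*) [Field K] :
    ∃ h ∉ J, ∀ φ : A →+* K, J ≤ RingHom.ker φ → φ h ≠ 0 →
      leadingExponents I J ⊆ leadingExponents (I.map (map φ)) ⊥ := by
  classical
  -- Dickson's lemma. The witness `h` is the product of the leading coefficients of one form for
  -- each minimal exponent; all other leading exponents come from monomial multiples of these forms.
  have hfin : {m | Minimal (· ∈ leadingExponents I J) m}.Finite :=
    (setOfPred_minimal_antichain _).finite_of_wellQuasiOrdered wellQuasiOrdered_le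
  have hG : ∀ m : {m | Minimal (· ∈ leadingExponents I J) m}, ∃ G ∈ I,
      G.IsHomogeneous m.1.degree ∧ coeff m.1 G ∉ J ∧
      ∀ m', MonomialOrder.lex.toSyn m.1 < MonomialOrder.lex.toSyn m' → coeff m' G ∈ J :=
    fun m => m.2.prop
  choose G hGI hGhom hGJ hGlt using hG
  have := hfin.fintype
  refine ⟨∏ m, coeff m.1 (G m), ?_, ?_⟩
  · rw [hJ.prod_mem_iff]
    rintro ⟨m, -, hm⟩
    exact hGJ m hm
  intro φ hφ hne m hm
  rw [map_prod, Finset.prod_ne_zero_iff] at hne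
  obtain ⟨m₀, hle, hmin⟩ := exists_minimal_le_of_wellFoundedLT (· ∈ leadingExponents I J) m hm
  obtain ⟨c, rfl⟩ := exists_add_of_le hle
  refine ⟨map φ (G ⟨m₀, hmin⟩) * monomial c 1, ?_, ?_, ?_, ?_⟩
  · exact Ideal.mul_mem_right _ _ (Ideal.mem_map_of_mem _ (hGI _))
  · rw [map_add]
    exact ((hGhom ⟨m₀, hmin⟩).map φ).mul (isHomogeneous_monomial _ rfl)
  · rw [coeff_mul_monomial]
    rw [mul_one, coeff_map, Ideal.mem_bot]
    exact hne ⟨m₀, hmin⟩ (Finset.mem_univ _)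
  · intro m' hm'
    rw [coeff_mul_monomial']
    split_ifs with hcm
    · obtain ⟨b, rfl⟩ := exists_add_of_le hcm
      rw [add_comm m₀ c, map_add, map_add, add_lt_add_iff_left] at hm'
      rw [add_tsub_cancel_left, mul_one, coeff_map, Ideal.mem_bot]
      exact hφ (hGlt ⟨m₀, hmin⟩ b hm')
    · exact Submodule.zero_mem _

/-- A minor of the coefficients of forms in `I` that is nonzero modulo a prime `J` bounds the
number of leading exponents modulo `J` from below. -/
theorem le_card_leadingExponents (I : Ideal (MvPolynomial σ A)) (J : Ideal A) [hJ : J.IsPrime]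
    {e r : ℕ} {u : Fin r → MvPolynomial σ A} (hu : ∀ i, u i ∈ I)
    (huhom : ∀ i, (u i).IsHomogeneous e) {m : Fin r → σ →₀ ℕ}
    (hdet : (Matrix.of fun i j => coeff (m j) (u i)).det ∉ J) :
    ∃ s : Finset (σ →₀ ℕ), (∀ x ∈ s, x ∈ leadingExponents I J ∧ x.degree = e) ∧ r ≤ s.card := by
  classical
  have hfin : {x | x ∈ leadingExponents I J ∧ x.degree = e}.Finite := by
    have : {x : σ →₀ ℕ | x.degree = e}.Finite := Finsupp.finite_of_degree_le e |>.subset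
      fun x hx => le_of_eq hx
    exact this.subset fun x hx => hx.2
  refine ⟨hfin.toFinset, fun x hx => by simpa using hx, ?_⟩
  by_contra hlt
  push Not at hlt
  let π := Ideal.Quotient.mk J
  let N : Matrix (Fin r) hfin.toFinset (A ⧸ J) := Matrix.of fun i x => π (coeff x.1 (u i))
  -- With fewer than `r` leading exponents, some nontrivial combination of the `u i` has all its
  -- coefficients at these exponents in `J`.
  have hninj : ¬ Function.Injective (Matrix.vecMulLinear N) := by
    intro hinj
    have := card_le_of_injective (A ⧸ J) _ hinj
    simp only [Fintype.card_fin, Fintype.card_coe] at this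
    omega
  obtain ⟨c, hc0, hc⟩ : ∃ c, Matrix.vecMul c N = 0 ∧ c ≠ 0 := by
    rw [← LinearMap.ker_eq_bot, Submodule.eq_bot_iff] at hninj
    push Not at hninj
    exact hninj
  choose a ha using fun i => Ideal.Quotient.mk_surjective (c i)
  let G : MvPolynomial σ A := ∑ i, C (a i) * u i
  have hGI : G ∈ I := Submodule.sum_mem _ fun i _ => Ideal.mul_mem_left _ _ (hu i)
  have hGhom : G.IsHomogeneous e := IsHomogeneous.sum _ _ _ fun i _ => (huhom i).C_mul _
  have hcoeff : ∀ x, π (coeff x G) = ∑ i, c i * π (coeff x (u i)) := by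
    intro x
    simp [G, coeff_sum, coeff_C_mul, ha, π]
  -- Otherwise the largest exponent whose coefficient is outside `J` would be a leading exponent,
  -- where the coefficient lies in `J` by the choice of `c`.
  have hall : ∀ x, coeff x G ∈ J := by
    by_contra hex
    push Not at hex
    obtain ⟨x₀, hx₀⟩ := hex
    let t := G.support.filter fun x => coeff x G ∉ J
    have hmt : ∀ x, coeff x G ∉ J → x ∈ t := fun x hx => by
      refine Finset.mem_filter.mpr ⟨mem_support_iff.mpr ?_, hx⟩
      rintro h0
      exact hx (h0 ▸ J.zero_mem)
    obtain ⟨x, hxt, hmax⟩ := t.exists_max_image MonomialOrder.lex.toSyn ⟨x₀, hmt _ hx₀⟩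
    obtain ⟨hxs, hxJ⟩ := Finset.mem_filter.mp hxt
    have hdeg : x.degree = e := by
      by_contra hne
      exact mem_support_iff.mp hxs (hGhom.coeff_eq_zero hne)
    have hxL : x ∈ hfin.toFinset := by
      rw [Set.Finite.mem_toFinset]
      refine ⟨⟨G, hGI, hdeg ▸ hGhom, hxJ, fun m' hm' => ?_⟩, hdeg⟩
      by_contra hm'J
      exact absurd (hmax m' (hmt _ hm'J)) (not_le.mpr hm')
    apply hxJ
    rw [← Ideal.Quotient.eq_zero_iff_mem]
    change π _ = 0
    rw [hcoeff]
    have := congrFun hc0 ⟨x, hxL⟩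
    simpa [Matrix.vecMul, dotProduct, N] using this
  apply hdet
  rw [← Ideal.Quotient.eq_zero_iff_mem, RingHom.map_det]
  refine Matrix.exists_vecMul_eq_zero_iff.mp ⟨c, hc, ?_⟩
  ext j
  have := hcoeff (m j)
  rw [(Ideal.Quotient.eq_zero_iff_mem).mpr (hall _)] at this
  simpa [Matrix.vecMul, dotProduct] using this.symm

/-- Forms with distinct leading exponents are linearly independent: in a relation, look at the
largest exponent that occurs. -/
theorem card_le_finrank_span_of_leadingExponents {K : Type*} [Field K]
    (I : Ideal (MvPolynomial σ K)) {e : ℕ} {X : Set (MvPolynomial σ K)}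
    [FiniteDimensional K (Submodule.span K X)]
    (hX : ∀ G ∈ I, G.IsHomogeneous e → G ∈ Submodule.span K X)
    (s : Finset (σ →₀ ℕ)) (hs : ∀ x ∈ s, x ∈ leadingExponents I ⊥ ∧ x.degree = e) :
    s.card ≤ Module.finrank K (Submodule.span K X) := by
  classical
  choose G hGI hGhom hG0 hGlt using fun x : s => (hs x x.2).1
  have hli : LinearIndependent K G := by
    rw [Fintype.linearIndependent_iff]
    intro c hc
    by_contra hex
    push Not at hex
    obtain ⟨i₀, hi₀⟩ := hex
    obtain ⟨x, hx, hmax⟩ := (Finset.univ.filter fun i => c i ≠ 0).exists_max_image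
      (fun i : s => MonomialOrder.lex.toSyn i.1) ⟨i₀, by simpa using hi₀⟩
    have hcx : c x ≠ 0 := by simpa using hx
    have := congrArg (coeff x.1) hc
    rw [coeff_sum, Finset.sum_eq_single x, coeff_smul, coeff_zero, smul_eq_mul,
      mul_eq_zero] at this
    · exact this.elim hcx fun h => hG0 x (Ideal.mem_bot.mpr h)
    · intro i _ hix
      rw [coeff_smul, smul_eq_mul, mul_eq_zero]
      by_cases hci : c i = 0
      · exact Or.inl hci
      · have hle := hmax i (by simpa using hci)
        have hlt := lt_of_le_of_ne hle fun h =>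
          hix (Subtype.ext (MonomialOrder.lex.toSyn.injective h))
        exact Or.inr (Ideal.mem_bot.mp (hGlt i x.1 hlt))
    · simp
  simpa using card_le_finrank_span_of_linearIndependent hli fun x =>
    hX _ (hGI x) ((hs x x.2).2 ▸ hGhom x)

end LeadingExponents

end OpenLoci

namespace OpenLoci

open MvPolynomial

/-! ### Finitely many degrees control the Hilbert functions of all specializations. -/

section Specialization

variable {σ A K : Type*} [CommRing A] [Field K]

instance finiteDimensional_homogeneousSubmodule [Finite σ] (e : ℕ) :
    FiniteDimensional K (homogeneousSubmodule σ K e) :=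
  Module.Finite.iff_fg.mpr (homogeneousSubmodule_fg σ K e)

theorem map_homogeneousComponent (φ : A →+* K) (e : ℕ) (G : MvPolynomial σ A) :
    map φ (homogeneousComponent e G) = homogeneousComponent e (map φ G) := by
  ext m
  simp only [coeff_map, coeff_homogeneousComponent]
  split_ifs <;> simp

/-- The space of specializations along `φ` of the forms of degree `e` in the ideal `I`. -/
noncomputable def specializedForms (I : Ideal (MvPolynomial σ A)) (φ : A →+* K) (e : ℕ) :
    Submodule K (MvPolynomial σ K) :=
  Submodule.span K (map φ '' {G | G ∈ I ∧ G.IsHomogeneous e})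

theorem specializedForms_le (I : Ideal (MvPolynomial σ A)) (φ : A →+* K) (e : ℕ) :
    specializedForms I φ e ≤ homogeneousSubmodule σ K e := by
  refine Submodule.span_le.mpr ?_
  rintro _ ⟨G, ⟨-, hG⟩, rfl⟩
  exact hG.map φ

instance finiteDimensional_specializedForms [Finite σ] (I : Ideal (MvPolynomial σ A))
    (φ : A →+* K) (e : ℕ) : FiniteDimensional K (specializedForms I φ e) :=
  Submodule.finiteDimensional_of_le (specializedForms_le I φ e)

theorem mem_specializedForms {I : Ideal (MvPolynomial σ A)}
    (hI : I.IsHomogeneous (homogeneousSubmodule σ A)) {φ : A →+* K}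
    (hφ : Function.Surjective φ) {e : ℕ} {G : MvPolynomial σ K} (hG : G ∈ I.map (map φ))
    (hGe : G.IsHomogeneous e) : G ∈ specializedForms I φ e := by
  obtain ⟨G', hG', rfl⟩ := (Ideal.mem_map_iff_of_surjective _ (map_surjective φ hφ)).mp hG
  refine Submodule.subset_span ⟨homogeneousComponent e G',
    ⟨homogeneousComponent_mem_of_mem hI hG' e, homogeneousComponent_isHomogeneous _ _⟩, ?_⟩
  rw [map_homogeneousComponent, homogeneousComponent_eq_self hGe]

/-- Lower bounds for the Hilbert function of all specializations of a homogeneous ideal over a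
noetherian ring need only be checked in finitely many degrees. -/
theorem exists_finset_forall_le_finrank_specializedForms [LinearOrder σ] [Finite σ]
    [IsNoetherianRing A] {I : Ideal (MvPolynomial σ A)}
    (hI : I.IsHomogeneous (homogeneousSubmodule σ A)) (r : ℕ → ℕ) :
    ∃ F : Finset ℕ, ∀ φ : A →+* K, Function.Surjective φ →
      (∀ e ∈ F, r e ≤ Module.finrank K (specializedForms I φ e)) →
        ∀ e, r e ≤ Module.finrank K (specializedForms I φ e) := by
  classical
  -- The induction runs over the closed set of those `φ` that kill `J`, with larger `J` treated
  -- first.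
  suffices H : ∀ J : Ideal A, ∃ F : Finset ℕ, ∀ φ : A →+* K, Function.Surjective φ →
      J ≤ RingHom.ker φ → (∀ e ∈ F, r e ≤ Module.finrank K (specializedForms I φ e)) →
        ∀ e, r e ≤ Module.finrank K (specializedForms I φ e) by
    obtain ⟨F, hF⟩ := H ⊥
    exact ⟨F, fun φ hφ => hF φ hφ bot_le⟩
  refine IsNoetherian.induction fun (J : Ideal A) ih => ?_
  have hsup : ∀ a ∉ J, ∃ F : Finset ℕ, ∀ φ : A →+* K, Function.Surjective φ →
      J ≤ RingHom.ker φ → φ a = 0 →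
      (∀ e ∈ F, r e ≤ Module.finrank K (specializedForms I φ e)) →
        ∀ e, r e ≤ Module.finrank K (specializedForms I φ e) := by
    intro a ha
    obtain ⟨F, hF⟩ := ih (J ⊔ Ideal.span {a}) (by
      refine lt_of_le_of_ne le_sup_left fun h => ha ?_
      rw [h]
      exact Ideal.mem_sup_right (Ideal.mem_span_singleton_self a))
    refine ⟨F, fun φ hφ hJ ha => hF φ hφ (sup_le hJ ?_)⟩
    rwa [Ideal.span_singleton_le_iff_mem, RingHom.mem_ker]
  by_cases hJ : J.IsPrime
  -- Either the bound already fails generically in some degree `e`, hence for every `φ` killing `J`,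
  -- and `{e}` suffices; or it holds generically in all degrees, hence for every `φ` with `φ h ≠ 0`,
  -- and only the smaller closed set `φ h = 0` requires testing.
  · by_cases hdeg : ∃ e, ∀ (u : Fin (r e) → MvPolynomial σ A) (m : Fin (r e) → σ →₀ ℕ),
        (∀ i, u i ∈ I) → (∀ i, (u i).IsHomogeneous e) →
          (Matrix.of fun i j => coeff (m j) (u i)).det ∈ J
    · obtain ⟨e, he⟩ := hdeg
      refine ⟨{e}, fun φ _ hφJ hle => ?_⟩
      exfalso
      have hle' := hle e (Finset.mem_singleton_self e)
      have : FiniteDimensional K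
          (Submodule.span K (map φ '' {G | G ∈ I ∧ G.IsHomogeneous e})) :=
        finiteDimensional_specializedForms I φ e
      obtain ⟨u, hu, m, hm⟩ := le_finrank_span_iff_exists_det_ne_zero.mp hle'
      choose G hG hGu using hu
      apply hm
      have h0 := hφJ (he G m (fun i => (hG i).1) fun i => (hG i).2)
      rw [RingHom.mem_ker, RingHom.map_det] at h0
      rw [← h0]
      congr 1
      ext i j
      simp [← hGu, coeff_map]
    · push Not at hdeg
      obtain ⟨h, hhJ, hh⟩ := exists_leadingExponents_subset_map I J K
      obtain ⟨F, hF⟩ := hsup h hhJ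
      refine ⟨F, fun φ hφ hφJ hle e => ?_⟩
      by_cases h0 : φ h = 0
      · exact hF φ hφ hφJ h0 hle e
      obtain ⟨u, m, huI, huhom, hdet⟩ := hdeg e
      obtain ⟨s, hs, hcard⟩ := le_card_leadingExponents I J huI huhom hdet
      have : FiniteDimensional K
          (Submodule.span K (map φ '' {G | G ∈ I ∧ G.IsHomogeneous e})) :=
        finiteDimensional_specializedForms I φ e
      exact hcard.trans (card_le_finrank_span_of_leadingExponents (I.map (map φ))
        (fun G hG hGe => mem_specializedForms hI hφ hG hGe) s
        fun x hx => ⟨hh φ hφJ h0 (hs x hx).1, (hs x hx).2⟩)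
  · by_cases htop : J = ⊤
    · refine ⟨∅, fun φ _ hφJ => ?_⟩
      exact (RingHom.ker_ne_top φ (top_le_iff.mp (htop ▸ hφJ))).elim
    rw [Ideal.isPrime_iff] at hJ
    push Not at hJ
    obtain ⟨a, b, hab, ha, hb⟩ := hJ htop
    obtain ⟨F₁, hF₁⟩ := hsup a ha
    obtain ⟨F₂, hF₂⟩ := hsup b hb
    refine ⟨F₁ ∪ F₂, fun φ hφ hφJ hle => ?_⟩
    -- For reducible `J` the closed set is the union of those of `J + (a)` and `J + (b)`.
    have h0 : φ a * φ b = 0 := by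
      rw [← map_mul]
      exact hφJ hab
    rcases mul_eq_zero.mp h0 with h | h
    · exact hF₁ φ hφ hφJ h fun e he => hle e (Finset.mem_union_left _ he)
    · exact hF₂ φ hφ hφJ h fun e he => hle e (Finset.mem_union_right _ he)

end Specialization

end OpenLoci

/-! ### Regular pairs in a domain and shifted graded pieces. -/

namespace OpenLoci

open MvPolynomial RingTheory.Sequence
open scoped Pointwise

theorem mem_smul_top_iff_mem_span_singleton {A : Type*} [CommRing A] {f x : A} :
    x ∈ (f • ⊤ : Submodule A A) ↔ x ∈ Ideal.span {f} := by
  rw [Submodule.mem_smul_pointwise_iff_exists, Ideal.mem_span_singleton']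
  simp [mul_comm]

theorem isRegular_pair_iff {A : Type*} [CommRing A] [IsDomain A] {f g : A} :
    IsRegular A [f, g] ↔ f ≠ 0 ∧ (∀ h, g * h ∈ Ideal.span {f} → h ∈ Ideal.span {f}) ∧
      Ideal.span {f, g} ≠ ⊤ := by
  have hf : IsSMulRegular A f ↔ f ≠ 0 := by
    rw [isSMulRegular_iff_right_eq_zero_of_smul]
    refine ⟨fun h h0 => one_ne_zero (h (1 : A) (by simp [h0])), fun h x hx => ?_⟩
    simpa [h] using hx
  rw [RingTheory.Sequence.isRegular_iff, isWeaklyRegular_cons_iff, isWeaklyRegular_cons_iff, hf, and_assoc]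
  refine and_congr_right fun _ => and_congr ?_ ?_
  · rw [and_iff_left (IsWeaklyRegular.nil _ _)]
    refine (isSMulRegular_quotient_iff_mem_of_smul_mem _ _).trans ?_
    simp only [mem_smul_top_iff_mem_span_singleton, smul_eq_mul]
  · rw [Ideal.ofList_cons, Ideal.ofList_singleton, ← Ideal.span_insert, smul_eq_mul,
      Ideal.mul_top, ne_comm]

theorem finrank_eq_finrank_inf_ker_add_finrank_map {K V V' : Type*} [Field K] [AddCommGroup V]
    [Module K V] [AddCommGroup V'] [Module K V'] (q : V →ₗ[K] V') (W : Submodule K V)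
    [FiniteDimensional K W] :
    Module.finrank K W =
      Module.finrank K (W ⊓ LinearMap.ker q : Submodule K V) + Module.finrank K (W.map q) := by
  rw [← LinearMap.finrank_range_add_finrank_ker (q.domRestrict W), LinearMap.range_domRestrict,
    LinearMap.ker_domRestrict, ← Submodule.map_comap_subtype, Submodule.finrank_map_subtype_eq,
    add_comm]

theorem exists_of_finrank_ker_le {K T V W : Type*} [Field K] [AddCommGroup T] [Module K T]
    [AddCommGroup V] [Module K V] [FiniteDimensional K V] [AddCommGroup W] [Module K W]
    {L : T →ₗ[K] V} {φ : V →ₗ[K] W} (hL : Function.Injective L)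
    (hLφ : ∀ t, L t ∈ LinearMap.ker φ)
    (hle : Module.finrank K (LinearMap.ker φ) ≤ Module.finrank K T) {x : V} (hx : φ x = 0) :
    ∃ t, L t = x := by
  have hrange : LinearMap.range L ≤ LinearMap.ker φ := by
    rintro _ ⟨t, rfl⟩
    exact hLφ t
  have heq := Submodule.eq_of_le_of_finrank_le hrange
    (hle.trans_eq (LinearMap.finrank_range_of_inj hL).symm)
  have hx' : x ∈ LinearMap.range L := heq ▸ hx
  exact hx'

section LowerForms

variable {σ k : Type*} [Field k]

variable (σ k) in
/-- The forms of degree `e - d`, where only `0` has negative degree. -/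
noncomputable def lowerForms (d e : ℕ) : Submodule k (MvPolynomial σ k) :=
  if d ≤ e then homogeneousSubmodule σ k (e - d) else ⊥

instance finiteDimensional_lowerForms [Finite σ] (d e : ℕ) :
    FiniteDimensional k (lowerForms σ k d e) := by
  by_cases h : d ≤ e
  · rw [lowerForms, if_pos h]
    infer_instance
  · rw [lowerForms, if_neg h]
    infer_instance

theorem lowerForms_zero (e : ℕ) : lowerForms σ k 0 e = homogeneousSubmodule σ k e := by
  simp [lowerForms]

theorem mul_mem_lowerForms {c d e : ℕ} {F s : MvPolynomial σ k} (hF : F.IsHomogeneous d)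
    (hs : s ∈ lowerForms σ k (c + d) e) : F * s ∈ lowerForms σ k c e := by
  unfold lowerForms at hs ⊢
  split_ifs at hs with h
  · rw [if_pos (by omega)]
    have := hF.mul hs
    rwa [show d + (e - (c + d)) = e - c by omega] at this
  · rw [(Submodule.mem_bot _).mp hs, mul_zero]
    exact Submodule.zero_mem _

/-- The component of degree `e - d`, which is `0` if `e < d`. -/
noncomputable def lowerComponent (d e : ℕ) (s : MvPolynomial σ k) : MvPolynomial σ k :=
  if d ≤ e then homogeneousComponent (e - d) s else 0

theorem lowerComponent_mem (d e : ℕ) (s : MvPolynomial σ k) :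
    lowerComponent d e s ∈ lowerForms σ k d e := by
  unfold lowerComponent lowerForms
  split_ifs
  · exact homogeneousComponent_isHomogeneous _ _
  · exact Submodule.zero_mem _

theorem lowerComponent_sub (d e : ℕ) (s t : MvPolynomial σ k) :
    lowerComponent d e (s - t) = lowerComponent d e s - lowerComponent d e t := by
  unfold lowerComponent
  split_ifs <;> simp

theorem lowerComponent_eq_self {d e : ℕ} {s : MvPolynomial σ k} (hs : s ∈ lowerForms σ k d e) :
    lowerComponent d e s = s := by
  unfold lowerComponent lowerForms at *
  split_ifs at * with h
  · exact homogeneousComponent_eq_self hs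
  · exact ((Submodule.mem_bot _).mp hs).symm

theorem homogeneousComponent_mul_left {d : ℕ} {F : MvPolynomial σ k} (hF : F.IsHomogeneous d)
    (e : ℕ) (s : MvPolynomial σ k) :
    homogeneousComponent e (F * s) = F * lowerComponent d e s := by
  classical
  have h := DirectSum.coe_decompose_mul_of_left_mem (homogeneousSubmodule σ k) (b := s) e
    (show F ∈ homogeneousSubmodule σ k d from hF)
  have hd : ∀ (P : MvPolynomial σ k) (i : ℕ),
      (DirectSum.decompose (homogeneousSubmodule σ k) P i : MvPolynomial σ k) =
        homogeneousComponent i P := fun P i => decomposition.decompose'_apply P i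
  rw [hd, hd] at h
  rw [h, lowerComponent]
  split_ifs <;> simp

theorem lowerComponent_mul_left {d : ℕ} {F : MvPolynomial σ k} (hF : F.IsHomogeneous d)
    (c e : ℕ) (s : MvPolynomial σ k) :
    lowerComponent c e (F * s) = F * lowerComponent (c + d) e s := by
  unfold lowerComponent
  split_ifs with h₁ h₂ h₂
  · rw [homogeneousComponent_mul_left hF, lowerComponent, if_pos (by omega), Nat.sub_sub]
  · rw [homogeneousComponent_mul_left hF, lowerComponent, if_neg (by omega)]
  · omega
  · simp

theorem lowerComponent_mem_ideal {I : Ideal (MvPolynomial σ k)}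
    (hI : I.IsHomogeneous (homogeneousSubmodule σ k)) (d e : ℕ) {s : MvPolynomial σ k}
    (hs : s ∈ I) : lowerComponent d e s ∈ I := by
  unfold lowerComponent
  split_ifs
  · exact homogeneousComponent_mem_of_mem hI hs _
  · exact I.zero_mem

theorem mem_of_forall_lowerComponent_mem {I : Ideal (MvPolynomial σ k)} (d : ℕ)
    {s : MvPolynomial σ k} (hs : ∀ e, lowerComponent d e s ∈ I) : s ∈ I := by
  rw [← sum_homogeneousComponent s]
  refine Submodule.sum_mem _ fun e _ => ?_
  simpa [lowerComponent] using hs (e + d)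

end LowerForms

/-! ### Regularity as a dimension count in the Koszul complex. -/

section Hilbert

variable {σ k : Type*} [Field k] (𝔭 : Ideal (MvPolynomial σ k))

/-- The forms of degree `e` in the ideal `𝔭`. -/
noncomputable def idealForms (e : ℕ) : Submodule k (MvPolynomial σ k) :=
  𝔭.restrictScalars k ⊓ homogeneousSubmodule σ k e

/-- The forms of degree `e` in the ideal generated by `𝔭` and two forms of degree `d`. -/
noncomputable def pairForms (d : ℕ) (F G : MvPolynomial σ k) (e : ℕ) :
    Submodule k (MvPolynomial σ k) :=
  idealForms 𝔭 e ⊔ ((lowerForms σ k d e).map (LinearMap.mulLeft k F) ⊔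
    (lowerForms σ k d e).map (LinearMap.mulLeft k G))

/-- The classes modulo `𝔭` of the forms of degree `e - d`. -/
noncomputable def quotientForms (d e : ℕ) : Submodule k (MvPolynomial σ k ⧸ 𝔭) :=
  (lowerForms σ k d e).map (Ideal.Quotient.mkₐ k 𝔭).toLinearMap

instance finiteDimensional_quotientForms [Finite σ] (d e : ℕ) :
    FiniteDimensional k (quotientForms 𝔭 d e) := by
  unfold quotientForms
  infer_instance

/-- The dimension in degree `e` of the ideal generated by a prime ideal `𝔭` and two forms of
degree `d` that are a regular sequence modulo `𝔭`. -/
noncomputable def regularRank (d e : ℕ) : ℕ :=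
  Module.finrank k (idealForms 𝔭 e) + 2 * Module.finrank k (quotientForms 𝔭 d e) -
    Module.finrank k (quotientForms 𝔭 (d + d) e)

/-- The degree `e` part of the differential `(u, w) ↦ f u + g w` of the Koszul complex. -/
noncomputable def koszulMap (d : ℕ) (f g : MvPolynomial σ k ⧸ 𝔭) (e : ℕ) :
    (quotientForms 𝔭 d e × quotientForms 𝔭 d e) →ₗ[k] MvPolynomial σ k ⧸ 𝔭 :=
  ((LinearMap.mulLeft k f).domRestrict _).coprod ((LinearMap.mulLeft k g).domRestrict _)

variable {𝔭}

theorem pairForms_le {d : ℕ} {F G : MvPolynomial σ k} (hF : F.IsHomogeneous d)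
    (hG : G.IsHomogeneous d) (e : ℕ) : pairForms 𝔭 d F G e ≤ homogeneousSubmodule σ k e := by
  have h : ∀ {P : MvPolynomial σ k}, P.IsHomogeneous d →
      (lowerForms σ k d e).map (LinearMap.mulLeft k P) ≤ homogeneousSubmodule σ k e := by
    intro P hP
    rw [Submodule.map_le_iff_le_comap, ← lowerForms_zero]
    exact fun s hs => mul_mem_lowerForms hP (by rwa [zero_add])
  exact sup_le inf_le_right (sup_le (h hF) (h hG))

theorem map_pairForms (d : ℕ) (F G : MvPolynomial σ k) (e : ℕ) :
    (pairForms 𝔭 d F G e).map (Ideal.Quotient.mkₐ k 𝔭).toLinearMap =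
      LinearMap.range (koszulMap 𝔭 d (Ideal.Quotient.mk 𝔭 F) (Ideal.Quotient.mk 𝔭 G) e) := by
  have h0 : (idealForms 𝔭 e).map (Ideal.Quotient.mkₐ k 𝔭).toLinearMap = ⊥ := by
    rw [eq_bot_iff, Submodule.map_le_iff_le_comap]
    intro s hs
    exact (Submodule.mem_bot k).mpr (Ideal.Quotient.eq_zero_iff_mem.mpr hs.1)
  have hmul : ∀ P : MvPolynomial σ k, (Ideal.Quotient.mkₐ k 𝔭).toLinearMap ∘ₗ
      LinearMap.mulLeft k P = LinearMap.mulLeft k (Ideal.Quotient.mk 𝔭 P) ∘ₗ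
        (Ideal.Quotient.mkₐ k 𝔭).toLinearMap := fun P => by
    refine LinearMap.ext fun s => ?_
    simp
  rw [pairForms, Submodule.map_sup, Submodule.map_sup, h0, bot_sup_eq, ← Submodule.map_comp,
    ← Submodule.map_comp, hmul, hmul, Submodule.map_comp, Submodule.map_comp, koszulMap,
    LinearMap.range_coprod, LinearMap.range_domRestrict, LinearMap.range_domRestrict]
  rfl

/-- Rank-nullity for `koszulMap` and for reduction modulo `𝔭`. The truncated subtraction in
`regularRank` is harmless, since the kernel has dimension at most `2 * finrank (quotientForms 𝔭 d
e)`. -/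
theorem regularRank_le_iff [Finite σ] {d : ℕ} {F G : MvPolynomial σ k} (hF : F.IsHomogeneous d)
    (hG : G.IsHomogeneous d) (e : ℕ) :
    regularRank 𝔭 d e ≤ Module.finrank k (pairForms 𝔭 d F G e) ↔
      Module.finrank k (LinearMap.ker
        (koszulMap 𝔭 d (Ideal.Quotient.mk 𝔭 F) (Ideal.Quotient.mk 𝔭 G) e)) ≤
          Module.finrank k (quotientForms 𝔭 (d + d) e) := by
  have : FiniteDimensional k (pairForms 𝔭 d F G e) :=
    Submodule.finiteDimensional_of_le (pairForms_le hF hG e)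
  have hinf : pairForms 𝔭 d F G e ⊓ LinearMap.ker (Ideal.Quotient.mkₐ k 𝔭).toLinearMap =
      idealForms 𝔭 e := by
    apply le_antisymm
    · intro s hs
      exact ⟨Ideal.Quotient.eq_zero_iff_mem.mp hs.2, pairForms_le hF hG e hs.1⟩
    · intro s hs
      exact ⟨(le_sup_left : _ ≤ pairForms 𝔭 d F G e) hs, Ideal.Quotient.eq_zero_iff_mem.mpr hs.1⟩
  have h₁ := finrank_eq_finrank_inf_ker_add_finrank_map
    (Ideal.Quotient.mkₐ k 𝔭).toLinearMap (pairForms 𝔭 d F G e)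
  have h₂ := LinearMap.finrank_range_add_finrank_ker
    (koszulMap 𝔭 d (Ideal.Quotient.mk 𝔭 F) (Ideal.Quotient.mk 𝔭 G) e)
  rw [hinf, map_pairForms] at h₁
  rw [Module.finrank_prod] at h₂
  rw [h₁, regularRank]
  omega

theorem mul_mem_quotientForms {c d e : ℕ} {F : MvPolynomial σ k} (hF : F.IsHomogeneous d)
    {t : MvPolynomial σ k ⧸ 𝔭} (ht : t ∈ quotientForms 𝔭 (c + d) e) :
    Ideal.Quotient.mk 𝔭 F * t ∈ quotientForms 𝔭 c e := by
  obtain ⟨s, hs, rfl⟩ := ht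
  exact ⟨F * s, mul_mem_lowerForms hF hs, by simp⟩

/-- Since `𝔭` is homogeneous, any cofactor of `F` may be replaced by its component of the right
degree. -/
theorem exists_mem_quotientForms_of_mem_span
    (hhom : 𝔭.IsHomogeneous (homogeneousSubmodule σ k)) {c d e : ℕ} {F : MvPolynomial σ k}
    (hF : F.IsHomogeneous d) {w : MvPolynomial σ k ⧸ 𝔭} (hw : w ∈ quotientForms 𝔭 c e)
    (hdvd : w ∈ Ideal.span {Ideal.Quotient.mk 𝔭 F}) :
    ∃ t ∈ quotientForms 𝔭 (c + d) e, Ideal.Quotient.mk 𝔭 F * t = w := by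
  obtain ⟨s, hs, rfl⟩ := hw
  obtain ⟨t, ht⟩ := Ideal.mem_span_singleton'.mp hdvd
  obtain ⟨T, rfl⟩ := Ideal.Quotient.mk_surjective t
  refine ⟨_, ⟨lowerComponent (c + d) e T, lowerComponent_mem _ _ _, rfl⟩, ?_⟩
  have hmem : F * T - s ∈ 𝔭 := by
    rw [← Ideal.Quotient.eq, map_mul, mul_comm]
    exact ht
  have := lowerComponent_mem_ideal hhom c e hmem
  rw [lowerComponent_sub, lowerComponent_mul_left hF, lowerComponent_eq_self hs,
    ← Ideal.Quotient.eq, map_mul] at this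
  exact this

/-- If `f u + g w = 0`, regularity gives `w = f t` with `t` of degree `e - 2d`, and `w` determines
`u` because `f ≠ 0` in a domain. -/
theorem finrank_ker_koszulMap_le [Finite σ] [𝔭.IsPrime]
    (hhom : 𝔭.IsHomogeneous (homogeneousSubmodule σ k)) {d : ℕ} {F G : MvPolynomial σ k}
    (hF : F.IsHomogeneous d) (h0 : Ideal.Quotient.mk 𝔭 F ≠ 0)
    (hreg : ∀ h, Ideal.Quotient.mk 𝔭 G * h ∈ Ideal.span {Ideal.Quotient.mk 𝔭 F} →
      h ∈ Ideal.span {Ideal.Quotient.mk 𝔭 F}) (e : ℕ) :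
    Module.finrank k (LinearMap.ker
        (koszulMap 𝔭 d (Ideal.Quotient.mk 𝔭 F) (Ideal.Quotient.mk 𝔭 G) e)) ≤
      Module.finrank k (quotientForms 𝔭 (d + d) e) := by
  set f := Ideal.Quotient.mk 𝔭 F
  set g := Ideal.Quotient.mk 𝔭 G
  have hker : ∀ x : LinearMap.ker (koszulMap 𝔭 d f g e), f * x.1.1 + g * x.1.2 = 0 := fun x => x.2
  let L : LinearMap.ker (koszulMap 𝔭 d f g e) →ₗ[k] MvPolynomial σ k ⧸ 𝔭 :=
    Submodule.subtype _ ∘ₗ LinearMap.snd k _ _ ∘ₗ Submodule.subtype _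
  have hL : ∀ x, L x ∈ (quotientForms 𝔭 (d + d) e).map (LinearMap.mulLeft k f) := by
    intro x
    have hmem : (x.1.2 : MvPolynomial σ k ⧸ 𝔭) ∈ Ideal.span {f} := by
      refine hreg _ (Ideal.mem_span_singleton'.mpr ⟨-x.1.1, ?_⟩)
      linear_combination -hker x
    obtain ⟨t, ht, htw⟩ := exists_mem_quotientForms_of_mem_span hhom hF x.1.2.2 hmem
    exact ⟨t, ht, htw⟩
  refine (LinearMap.finrank_le_finrank_of_injective (f := L.codRestrict _ hL) ?_).trans
    (Submodule.finrank_map_le _ _)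
  refine (injective_iff_map_eq_zero _).mpr fun x hx => ?_
  have h2 : (x.1.2 : MvPolynomial σ k ⧸ 𝔭) = 0 := congrArg Subtype.val hx
  have h1 := hker x
  rw [h2, mul_zero, add_zero, mul_eq_zero] at h1
  exact Subtype.ext (Prod.ext (Subtype.ext (h1.resolve_left h0)) (Subtype.ext h2))

/-- The trivial syzygies `(-g t, f t)` form a copy of `quotientForms 𝔭 (d + d) e` inside the kernel;
by the dimension bound they fill it. -/
theorem exists_of_mem_ker_koszulMap [Finite σ] [𝔭.IsPrime] {d : ℕ} {F G : MvPolynomial σ k}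
    (hF : F.IsHomogeneous d) (hG : G.IsHomogeneous d) (h0 : Ideal.Quotient.mk 𝔭 F ≠ 0) {e : ℕ}
    (hle : Module.finrank k (LinearMap.ker
        (koszulMap 𝔭 d (Ideal.Quotient.mk 𝔭 F) (Ideal.Quotient.mk 𝔭 G) e)) ≤
      Module.finrank k (quotientForms 𝔭 (d + d) e)) {u w : MvPolynomial σ k ⧸ 𝔭}
    (hu : u ∈ quotientForms 𝔭 d e) (hw : w ∈ quotientForms 𝔭 d e)
    (huw : Ideal.Quotient.mk 𝔭 F * u + Ideal.Quotient.mk 𝔭 G * w = 0) :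
    w ∈ Ideal.span {Ideal.Quotient.mk 𝔭 F} := by
  set f := Ideal.Quotient.mk 𝔭 F
  set g := Ideal.Quotient.mk 𝔭 G
  let L : quotientForms 𝔭 (d + d) e →ₗ[k] quotientForms 𝔭 d e × quotientForms 𝔭 d e :=
    LinearMap.prod
      (((-LinearMap.mulLeft k g).domRestrict _).codRestrict _ fun t => by
        have := mul_mem_quotientForms hG t.2
        simpa [g] using this)
      (((LinearMap.mulLeft k f).domRestrict _).codRestrict _ fun t =>
        mul_mem_quotientForms hF t.2)
  have hLker : ∀ t, L t ∈ LinearMap.ker (koszulMap 𝔭 d f g e) := fun t => by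
    change f * ((-LinearMap.mulLeft k g) t.1) + g * (f * t.1) = 0
    simp only [LinearMap.neg_apply, LinearMap.mulLeft_apply]
    ring
  have hinj : Function.Injective L := by
    refine (injective_iff_map_eq_zero _).mpr fun t ht => ?_
    have h2 : f * t.1 = 0 := congrArg (fun x => (x.2 : MvPolynomial σ k ⧸ 𝔭)) ht
    exact Subtype.ext ((mul_eq_zero.mp h2).resolve_left h0)
  obtain ⟨t, ht⟩ := exists_of_finrank_ker_le hinj hLker hle (x := (⟨u, hu⟩, ⟨w, hw⟩)) huw
  have h2 : f * t.1 = w := congrArg (fun x => (x.2 : MvPolynomial σ k ⧸ 𝔭)) ht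
  exact Ideal.mem_span_singleton'.mpr ⟨t.1, by rw [mul_comm, h2]⟩

theorem le_ker_constantCoeff (hne : 𝔭 ≠ ⊤)
    (hhom : 𝔭.IsHomogeneous (homogeneousSubmodule σ k)) :
    𝔭 ≤ RingHom.ker (constantCoeff (R := k) (σ := σ)) := by
  intro P hP
  have h := homogeneousComponent_mem_of_mem hhom hP 0
  rw [homogeneousComponent_zero] at h
  rw [RingHom.mem_ker, constantCoeff_eq]
  by_contra hc
  exact hne (Ideal.eq_top_of_isUnit_mem _ h ((isUnit_iff_ne_zero.mpr hc).map C))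

theorem constantCoeff_eq_zero_of_isHomogeneous {d : ℕ} (hd : 0 < d) {F : MvPolynomial σ k}
    (hF : F.IsHomogeneous d) : constantCoeff F = 0 := by
  rw [constantCoeff_eq]
  exact hF.coeff_eq_zero (by simpa using hd.ne)

/-- Every element of `𝔭 + (F, G)` has zero constant term; here `d > 0` is essential. -/
theorem span_pair_mk_ne_top [𝔭.IsPrime] (hhom : 𝔭.IsHomogeneous (homogeneousSubmodule σ k))
    {d : ℕ} (hd : 0 < d) {F G : MvPolynomial σ k} (hF : F.IsHomogeneous d)
    (hG : G.IsHomogeneous d) :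
    Ideal.span {Ideal.Quotient.mk 𝔭 F, Ideal.Quotient.mk 𝔭 G} ≠ ⊤ := by
  intro htop
  have hsub : 𝔭 ⊔ Ideal.span {F, G} ≤ RingHom.ker (constantCoeff (R := k) (σ := σ)) := by
    refine sup_le (le_ker_constantCoeff (Ideal.IsPrime.ne_top ‹_›) hhom) ?_
    rw [Ideal.span_le]
    rintro P (rfl | rfl)
    · exact constantCoeff_eq_zero_of_isHomogeneous hd hF
    · exact constantCoeff_eq_zero_of_isHomogeneous hd hG
  have h1 : (1 : MvPolynomial σ k ⧸ 𝔭) ∈ (Ideal.span {F, G}).map (Ideal.Quotient.mk 𝔭) := by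
    rw [Ideal.map_span, Set.image_pair, htop]
    exact Submodule.mem_top
  rw [← map_one (Ideal.Quotient.mk 𝔭), ← Ideal.mem_comap,
    Ideal.comap_map_of_surjective _ Ideal.Quotient.mk_surjective, sup_comm,
    ← RingHom.ker_eq_comap_bot, Ideal.mk_ker] at h1
  have := hsub h1
  simp at this

/-- Two forms of positive degree are a regular sequence modulo a homogeneous prime ideal if and
only if the ideal they generate is as large as possible in every degree. -/
theorem isRegular_mk_pair_iff [Finite σ] [𝔭.IsPrime]
    (hhom : 𝔭.IsHomogeneous (homogeneousSubmodule σ k)) {d : ℕ} (hd : 0 < d)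
    {F G : MvPolynomial σ k} (hF : F.IsHomogeneous d) (hG : G.IsHomogeneous d) :
    IsRegular (MvPolynomial σ k ⧸ 𝔭) [Ideal.Quotient.mk 𝔭 F, Ideal.Quotient.mk 𝔭 G] ↔
      ∀ e, regularRank 𝔭 d e ≤ Module.finrank k (pairForms 𝔭 d F G e) := by
  simp only [regularRank_le_iff hF hG]
  rw [isRegular_pair_iff]
  constructor
  · rintro ⟨h0, hreg, -⟩
    exact finrank_ker_koszulMap_le hhom hF h0 hreg
  intro hle
  have h0 : Ideal.Quotient.mk 𝔭 F ≠ 0 := by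
    intro h0
    -- Degree `e = d` detects `f = 0`: then `(1, 0)` is a syzygy, while there are no nonzero forms
    -- of degree `-d`.
    have hbot : quotientForms 𝔭 (d + d) d = ⊥ := by
      rw [quotientForms, lowerForms, if_neg (by omega), Submodule.map_bot]
    have hker := hle d
    rw [hbot, finrank_bot, Nat.le_zero, Submodule.finrank_eq_zero] at hker
    have h1 : (1 : MvPolynomial σ k ⧸ 𝔭) ∈ quotientForms 𝔭 d d :=
      by
      refine ⟨1, ?_, by simp⟩
      rw [lowerForms, if_pos le_rfl, Nat.sub_self]
      exact isHomogeneous_one σ k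
    have hmem : ((⟨1, h1⟩, 0) : quotientForms 𝔭 d d × quotientForms 𝔭 d d) ∈ LinearMap.ker
        (koszulMap 𝔭 d (Ideal.Quotient.mk 𝔭 F) (Ideal.Quotient.mk 𝔭 G) d) := by
      change Ideal.Quotient.mk 𝔭 F * 1 + Ideal.Quotient.mk 𝔭 G * 0 = 0
      rw [h0, zero_mul, mul_zero, add_zero]
    rw [hker, Submodule.mem_bot] at hmem
    exact one_ne_zero (congrArg (fun x => (x.1 : MvPolynomial σ k ⧸ 𝔭)) hmem)
  refine ⟨h0, fun h hh => ?_, fun htop => ?_⟩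
  · obtain ⟨H, rfl⟩ := Ideal.Quotient.mk_surjective h
    obtain ⟨t, ht⟩ := Ideal.mem_span_singleton'.mp hh
    obtain ⟨T, rfl⟩ := Ideal.Quotient.mk_surjective t
    have hmem : F * T - G * H ∈ 𝔭 := by
      rw [← Ideal.Quotient.eq, map_mul, map_mul, mul_comm]
      exact ht
    suffices hH : H ∈ 𝔭 ⊔ Ideal.span {F} by
      have := Ideal.mem_map_of_mem (Ideal.Quotient.mk 𝔭) hH
      rwa [Ideal.map_sup, Ideal.map_quotient_self, bot_sup_eq, Ideal.map_span,
        Set.image_singleton] at this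
    refine mem_of_forall_lowerComponent_mem d fun e => ?_
    have he := homogeneousComponent_mem_of_mem hhom hmem e
    rw [map_sub, homogeneousComponent_mul_left hF, homogeneousComponent_mul_left hG,
      ← Ideal.Quotient.eq, map_mul, map_mul] at he
    have hspan := exists_of_mem_ker_koszulMap (𝔭 := 𝔭) hF hG h0 (hle e)
      (u := Ideal.Quotient.mk 𝔭 (lowerComponent d e T))
      (w := -Ideal.Quotient.mk 𝔭 (lowerComponent d e H))
      ⟨_, lowerComponent_mem d e T, rfl⟩
      (Submodule.neg_mem _ ⟨_, lowerComponent_mem d e H, rfl⟩)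
      (by linear_combination he)
    rw [Ideal.neg_mem_iff, ← Set.image_singleton, ← Ideal.map_span, ← Ideal.mem_comap,
      Ideal.comap_map_of_surjective _ Ideal.Quotient.mk_surjective, sup_comm,
      ← RingHom.ker_eq_comap_bot, Ideal.mk_ker] at hspan
    exact hspan
  · exact span_pair_mk_ne_top hhom hd hF hG htop

end Hilbert

end OpenLoci

/-! ### Generic pairs of forms and Zariski openness. -/

namespace OpenLoci

open MvPolynomial RingTheory.Sequence
open scoped LinearAlgebra.Projectivization

variable {k : Type*} [Field k] {n d : ℕ}

theorem degree_mon (m : Mon n d) : m.1.degree = d := by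
  have h := (Finset.mem_finsuppAntidiag.mp m.2).1
  rw [Finsupp.degree_eq_sum]
  exact h

theorem form_isHomogeneous (a : Mon n d → k) : (form a).IsHomogeneous d := by
  refine IsHomogeneous.sum _ _ _ fun i _ => ?_
  exact Submodule.smul_mem (homogeneousSubmodule _ k d) _
    (isHomogeneous_monomial _ (degree_mon i))

variable (k) in
/-- The form of degree `d` whose coefficients are indeterminates. -/
noncomputable def genericForm (n d : ℕ) (j : Fin 2) :
    MvPolynomial (Fin (n + 1)) (MvPolynomial (Fin 2 × Mon n d) k) :=
  ∑ i : Mon n d, monomial i.1 (X (j, i))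

theorem genericForm_isHomogeneous (j : Fin 2) : (genericForm k n d j).IsHomogeneous d :=
  IsHomogeneous.sum _ _ _ fun i _ => isHomogeneous_monomial _ (degree_mon i)

theorem map_eval_genericForm (v : PairCoord k n d) (j : Fin 2) :
    map (eval v) (genericForm k n d j) = form fun i => v (j, i) := by
  simp [genericForm, form, map_monomial, smul_monomial]

theorem map_eval_map_C (v : PairCoord k n d) (P : MvPolynomial (Fin (n + 1)) k) :
    map (eval v) (map C P) = P := by
  rw [map_map]
  convert map_id P
  ext
  simp

variable (𝔭 : Ideal (MvPolynomial (Fin (n + 1)) k))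

/-- The ideal generated by `𝔭` and two forms of degree `d` with indeterminate coefficients. -/
noncomputable def genericIdeal (d : ℕ) :
    Ideal (MvPolynomial (Fin (n + 1)) (MvPolynomial (Fin 2 × Mon n d) k)) :=
  Ideal.span (map C '' {P | P ∈ 𝔭 ∧ ∃ e, P.IsHomogeneous e} ∪ Set.range (genericForm k n d))

theorem genericIdeal_isHomogeneous :
    (genericIdeal 𝔭 d).IsHomogeneous (homogeneousSubmodule _ _) := by
  refine Ideal.homogeneous_span _ _ ?_
  rintro _ (⟨P, ⟨-, e, hP⟩, rfl⟩ | ⟨j, rfl⟩)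
  · exact ⟨e, hP.map C⟩
  · exact ⟨d, genericForm_isHomogeneous j⟩

/-- Generators of the forms of degree `e` in `genericIdeal 𝔭 d`. -/
def genericGenerators (d e : ℕ) :
    Set (MvPolynomial (Fin (n + 1)) (MvPolynomial (Fin 2 × Mon n d) k)) :=
  map C '' (idealForms 𝔭 e : Set _) ∪
    {G | ∃ j, ∃ s ∈ lowerForms (Fin (n + 1)) k d e, G = genericForm k n d j * map C s}

theorem span_map_genericGenerators (v : PairCoord k n d) (e : ℕ) :
    Submodule.span k (map (eval v) '' genericGenerators 𝔭 d e) =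
      pairForms 𝔭 d (form fun i => v (0, i)) (form fun i => v (1, i)) e := by
  apply le_antisymm
  · rw [Submodule.span_le]
    rintro _ ⟨_, ⟨P, hP, rfl⟩ | ⟨j, s, hs, rfl⟩, rfl⟩
    · rw [map_eval_map_C]
      exact Submodule.mem_sup_left hP
    · rw [map_mul, map_eval_genericForm, map_eval_map_C]
      refine Submodule.mem_sup_right ?_
      fin_cases j
      · exact Submodule.mem_sup_left ⟨s, hs, rfl⟩
      · exact Submodule.mem_sup_right ⟨s, hs, rfl⟩
  · have h : ∀ j : Fin 2, (lowerForms (Fin (n + 1)) k d e).map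
        (LinearMap.mulLeft k (form fun i => v (j, i))) ≤
          Submodule.span k (map (eval v) '' genericGenerators 𝔭 d e) := by
      rintro j _ ⟨s, hs, rfl⟩
      refine Submodule.subset_span ⟨_, Or.inr ⟨j, s, hs, rfl⟩, ?_⟩
      rw [map_mul, map_eval_genericForm, map_eval_map_C]
      rfl
    refine sup_le (fun P hP => ?_) (sup_le (h 0) (h 1))
    exact Submodule.subset_span ⟨_, Or.inl ⟨P, hP, rfl⟩, map_eval_map_C v P⟩

theorem isHomogeneous_of_mem_genericGenerators {e : ℕ}
    {G : MvPolynomial (Fin (n + 1)) (MvPolynomial (Fin 2 × Mon n d) k)}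
    (hG : G ∈ genericGenerators 𝔭 d e) : G ∈ genericIdeal 𝔭 d ∧ G.IsHomogeneous e := by
  rcases hG with ⟨P, hP, rfl⟩ | ⟨j, s, hs, rfl⟩
  · exact ⟨Ideal.subset_span (Or.inl ⟨P, ⟨hP.1, e, hP.2⟩, rfl⟩), IsHomogeneous.map hP.2 C⟩
  · refine ⟨Ideal.mul_mem_right _ _ (Ideal.subset_span (Or.inr ⟨j, rfl⟩)), ?_⟩
    unfold lowerForms at hs
    split_ifs at hs with hde
    · have := (genericForm_isHomogeneous (k := k) (n := n) (d := d) j).mul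
        (IsHomogeneous.map hs (C (σ := Fin 2 × Mon n d)))
      rwa [Nat.add_sub_cancel' hde] at this
    · rw [(Submodule.mem_bot _).mp hs, map_zero, mul_zero]
      exact isHomogeneous_zero _ _ _

/-- The degree in the parameters is 0 for elements of `𝔭` and 1 for multiples of a generic form.
Being constant along each row of a minor, it makes the minor homogeneous; arbitrary forms in
`genericIdeal` need not have this property. -/
theorem exists_isHomogeneous_coeff_of_mem_genericGenerators {e : ℕ}
    {G : MvPolynomial (Fin (n + 1)) (MvPolynomial (Fin 2 × Mon n d) k)}
    (hG : G ∈ genericGenerators 𝔭 d e) : ∃ ε, ∀ m, (coeff m G).IsHomogeneous ε := by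
  classical
  rcases hG with ⟨P, -, rfl⟩ | ⟨j, s, -, rfl⟩
  · exact ⟨0, fun m => by
      rw [coeff_map]
      exact isHomogeneous_C _ _⟩
  · refine ⟨1, fun m => ?_⟩
    rw [genericForm, Finset.sum_mul, coeff_sum]
    refine IsHomogeneous.sum _ _ _ fun i _ => ?_
    rw [coeff_monomial_mul', coeff_map]
    split_ifs
    · exact (isHomogeneous_X k (j, i)).mul (isHomogeneous_C _ _)
    · exact isHomogeneous_zero _ _ _

/-- Links the finiteness theorem, which concerns all forms of the generic ideal, with the minors,
which are built only from `genericGenerators`. -/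
theorem specializedForms_genericIdeal
    (hhom : 𝔭.IsHomogeneous (homogeneousSubmodule (Fin (n + 1)) k)) (v : PairCoord k n d)
    (e : ℕ) : specializedForms (genericIdeal 𝔭 d) (eval v) e =
      pairForms 𝔭 d (form fun i => v (0, i)) (form fun i => v (1, i)) e := by
  apply le_antisymm
  · refine Submodule.span_le.mpr ?_
    rintro _ ⟨G, ⟨hG, hGe⟩, rfl⟩
    have hle : genericIdeal 𝔭 d ≤ (𝔭 ⊔ Ideal.span
        {(form fun i => v (0, i)), (form fun i => v (1, i))}).comap (map (eval v)) := by
      refine Ideal.span_le.mpr ?_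
      rintro _ (⟨P, ⟨hP, -⟩, rfl⟩ | ⟨j, rfl⟩)
      · rw [SetLike.mem_coe, Ideal.mem_comap, map_eval_map_C]
        exact Ideal.mem_sup_left hP
      · rw [SetLike.mem_coe, Ideal.mem_comap, map_eval_genericForm]
        refine Ideal.mem_sup_right (Ideal.subset_span ?_)
        fin_cases j
        · exact Or.inl rfl
        · exact Or.inr rfl
    obtain ⟨P, hP, Q, hQ, hPQ⟩ := Submodule.mem_sup.mp (hle hG)
    obtain ⟨a, b, rfl⟩ := Ideal.mem_span_pair.mp hQ
    rw [SetLike.mem_coe, ← homogeneousComponent_eq_self (hGe.map (eval v)), ← hPQ, map_add,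
      map_add, mul_comm a, mul_comm b, homogeneousComponent_mul_left (form_isHomogeneous _),
      homogeneousComponent_mul_left (form_isHomogeneous _)]
    refine Submodule.add_mem_sup ⟨homogeneousComponent_mem_of_mem hhom hP e,
      homogeneousComponent_isHomogeneous _ _⟩ (Submodule.add_mem_sup ?_ ?_)
    · exact ⟨_, lowerComponent_mem _ _ _, rfl⟩
    · exact ⟨_, lowerComponent_mem _ _ _, rfl⟩
  · rw [← span_map_genericGenerators]
    exact Submodule.span_mono (Set.image_mono fun G hG =>
      isHomogeneous_of_mem_genericGenerators 𝔭 hG)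

/-- The minors of size `r` of the coefficients of `genericGenerators 𝔭 d e`. -/
def genericMinors (d e r : ℕ) : Set (MvPolynomial (Fin 2 × Mon n d) k) :=
  {P | ∃ u : Fin r → MvPolynomial (Fin (n + 1)) (MvPolynomial (Fin 2 × Mon n d) k),
    (∀ i, u i ∈ genericGenerators 𝔭 d e) ∧ ∃ m : Fin r → Fin (n + 1) →₀ ℕ,
      P = (Matrix.of fun i j => coeff (m j) (u i)).det}

theorem isHomogeneous_of_mem_genericMinors {e r : ℕ} {P : MvPolynomial (Fin 2 × Mon n d) k}
    (hP : P ∈ genericMinors 𝔭 d e r) : ∃ ε, P.IsHomogeneous ε := by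
  obtain ⟨u, hu, m, rfl⟩ := hP
  choose ε hε using fun i => exists_isHomogeneous_coeff_of_mem_genericGenerators 𝔭 (hu i)
  refine ⟨∑ i, ε i, ?_⟩
  rw [← Matrix.det_transpose, Matrix.det_apply]
  refine IsHomogeneous.sum _ _ _ fun τ _ => ?_
  rw [Units.smul_def]
  have hprod := IsHomogeneous.prod Finset.univ (fun i => coeff (m (τ i)) (u i)) ε
    fun i _ => hε i (m (τ i))
  exact zsmul_mem (show _ ∈ homogeneousSubmodule _ k _ from hprod) _

theorem le_finrank_pairForms_iff (v : PairCoord k n d) (e r : ℕ) :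
    r ≤ Module.finrank k
        (pairForms 𝔭 d (form fun i => v (0, i)) (form fun i => v (1, i)) e) ↔
      ∃ P ∈ genericMinors 𝔭 d e r, eval v P ≠ 0 := by
  have hfin : FiniteDimensional k
      (Submodule.span k (map (eval v) '' genericGenerators 𝔭 d e)) := by
    rw [span_map_genericGenerators]
    exact Submodule.finiteDimensional_of_le
      (pairForms_le (form_isHomogeneous _) (form_isHomogeneous _) e)
  have hdet : ∀ (u : Fin r → MvPolynomial (Fin (n + 1)) (MvPolynomial (Fin 2 × Mon n d) k))
      (m : Fin r → Fin (n + 1) →₀ ℕ), eval v (Matrix.of fun i j => coeff (m j) (u i)).det =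
        (Matrix.of fun i j => coeff (m j) (map (eval v) (u i))).det := fun u m => by
    rw [RingHom.map_det]
    congr 1
  rw [← span_map_genericGenerators, le_finrank_span_iff_exists_det_ne_zero]
  constructor
  · rintro ⟨u, hu, m, hm⟩
    choose G hG hGu using hu
    obtain rfl : (fun i => map (eval v) (G i)) = u := funext hGu
    exact ⟨_, ⟨G, hG, m, rfl⟩, by rwa [hdet]⟩
  · rintro ⟨_, ⟨u, hu, m, rfl⟩, hm⟩
    exact ⟨fun i => map (eval v) (u i), fun i => ⟨_, hu i, rfl⟩, m, by rwa [← hdet]⟩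

/-- A finite union of zero loci is cut out by the products with one factor from each `T e`. -/
theorem isZariskiOpen_of_forall_mem_iff {ι : Type*} {U : Set (ℙ k (ι → k))} (F : Finset ℕ)
    (T : ℕ → Set (MvPolynomial ι k)) (hT : ∀ e, ∀ P ∈ T e, ∃ ε : ℕ, P.IsHomogeneous ε)
    (hU : ∀ x, x ∈ U ↔ ∀ e ∈ F, ∃ P ∈ T e, eval x.rep P ≠ 0) : IsZariskiOpen U := by
  refine ⟨{Q | ∃ P : F → MvPolynomial ι k, (∀ e : F, P e ∈ T e) ∧ Q = ∏ e, P e}, ?_, ?_⟩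
  · rintro _ ⟨P, hP, rfl⟩
    choose ε hε using fun e : F => hT e (P e) (hP e)
    exact ⟨_, IsHomogeneous.prod _ _ ε fun e _ => hε e⟩
  · ext x
    rw [Set.mem_compl_iff, hU]
    constructor
    · rintro h _ ⟨P, hP, rfl⟩
      push Not at h
      obtain ⟨e, he, h⟩ := h
      rw [map_prod]
      exact Finset.prod_eq_zero (Finset.mem_univ ⟨e, he⟩) (h _ (hP ⟨e, he⟩))
    · intro h hex
      choose P hP hne using fun e : F => hex e e.2
      have := h _ ⟨P, hP, rfl⟩
      rw [map_prod, Finset.prod_eq_zero_iff] at this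
      obtain ⟨e, -, he⟩ := this
      exact hne e he

theorem not_isRegularPair_of_degree_zero [𝔭.IsPrime] (v : PairCoord k n 0) :
    ¬ IsRegularPair 𝔭 v := by
  intro h
  obtain ⟨h0, -, htop⟩ := isRegular_pair_iff.mp h
  apply htop
  have hC := totalDegree_eq_zero_iff_eq_C.mp
    ((totalDegree_zero_iff_isHomogeneous _).mpr (form_isHomogeneous fun i => v (0, i)))
  refine Ideal.eq_top_of_isUnit_mem _ (Ideal.subset_span (Set.mem_insert _ _)) ?_
  rw [hC] at h0 ⊢
  refine IsUnit.map _ (IsUnit.map C (isUnit_iff_ne_zero.mpr fun h => h0 ?_))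
  rw [h, map_zero, map_zero]

theorem isZariskiOpen_regularLocus [𝔭.IsPrime]
    (hhom : 𝔭.IsHomogeneous (homogeneousSubmodule (Fin (n + 1)) k)) (d : ℕ) :
    IsZariskiOpen (regularLocus 𝔭 d) := by
  rcases Nat.eq_zero_or_pos d with rfl | hd
  -- The locus is empty, so a single unsatisfiable condition describes it.
  · refine isZariskiOpen_of_forall_mem_iff {0} (fun _ => ∅) (by simp) fun x => ?_
    have := not_isRegularPair_of_degree_zero 𝔭 x.rep
    exact iff_of_false this (by simp)
  obtain ⟨F, hF⟩ := exists_finset_forall_le_finrank_specializedForms (K := k)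
    (genericIdeal_isHomogeneous (d := d) 𝔭) (regularRank 𝔭 d)
  refine isZariskiOpen_of_forall_mem_iff F (fun e => genericMinors 𝔭 d e (regularRank 𝔭 d e))
    (fun e P => isHomogeneous_of_mem_genericMinors 𝔭) fun x => ?_
  simp only [← le_finrank_pairForms_iff]
  refine (isRegular_mk_pair_iff hhom hd (form_isHomogeneous _) (form_isHomogeneous _)).trans
    ⟨fun h e _ => h e, fun h => ?_⟩
  have hsurj : Function.Surjective (eval x.rep : MvPolynomial (Fin 2 × Mon n d) k →+* k) :=
    fun c => ⟨C c, by simp⟩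
  have hspec := fun e => specializedForms_genericIdeal (d := d) 𝔭 hhom x.rep e
  have hle := hF (eval x.rep) hsurj fun e he => (h e he).trans_eq (by rw [hspec])
  exact fun e => (hle e).trans_eq (by rw [hspec])

end OpenLoci

/-! ### Depth and prime avoidance. -/

namespace OpenLoci

open MvPolynomial RingTheory.Sequence
open scoped LinearAlgebra.Projectivization Pointwise

theorem two_le_grade {A : Type*} [CommRing A] {I : Ideal A} {f g : A} (h : IsRegular A [f, g])
    (hf : f ∈ I) (hg : g ∈ I) : 2 ≤ grade I := by
  have hmem : ∀ r ∈ [f, g], r ∈ I := by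
    simp [hf, hg]
  exact le_iSup_of_le [f, g] (le_iSup_of_le h (le_iSup_of_le hmem le_rfl))

theorem exists_of_two_le_grade {A : Type*} [CommRing A] [IsDomain A] {I : Ideal A}
    (h : 2 ≤ grade I) : ∃ u ∈ I, ∃ v ∈ I, u ≠ 0 ∧
      ∀ a, v * a ∈ Ideal.span {u} → a ∈ Ideal.span {u} := by
  have h1 : 1 < grade I := lt_of_lt_of_le (by norm_num) h
  simp only [grade, lt_iSup_iff] at h1
  obtain ⟨rs, hreg, hmem, hlen⟩ := h1
  have hlen' : 1 < rs.length := by exact_mod_cast hlen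
  match rs, hlen' with
  | u :: v :: t, _ =>
    refine ⟨u, hmem u (by simp), v, hmem v (by simp), ?_⟩
    obtain ⟨hu, hvt⟩ := (isWeaklyRegular_cons_iff A u (v :: t)).mp hreg.toIsWeaklyRegular
    have hv := (isWeaklyRegular_cons_iff _ v t).mp hvt |>.1
    refine ⟨?_, fun a ha => ?_⟩
    · rintro rfl
      exact one_ne_zero (isSMulRegular_iff_right_eq_zero_of_smul.mp hu (1 : A) (by simp))
    · rw [← mem_smul_top_iff_mem_span_singleton] at ha ⊢
      exact (isSMulRegular_quotient_iff_mem_of_smul_mem _ _).mp hv a ha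

/-- If `I` has grade at least two, then it does not multiply any element outside a nonzero
principal ideal into this ideal. -/
theorem mem_span_singleton_of_forall_mul_mem {A : Type*} [CommRing A] [IsDomain A] {I : Ideal A}
    (hI : 2 ≤ grade I) {f : A} (hf : f ≠ 0) {h : A} (hh : ∀ x ∈ I, x * h ∈ Ideal.span {f}) :
    h ∈ Ideal.span {f} := by
  obtain ⟨u, hu, v, hv, hu0, huv⟩ := exists_of_two_le_grade hI
  obtain ⟨a, ha⟩ := Ideal.mem_span_singleton'.mp (hh u hu)
  obtain ⟨b, hb⟩ := Ideal.mem_span_singleton'.mp (hh v hv)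
  -- From `u h = a f` and `v h = b f`; regularity of `v` modulo `u` then gives `a = c u`, and
  -- cancelling `u` yields `h = c f`.
  have hab : v * a = b * u := mul_left_cancel₀ hf (by linear_combination v * ha - u * hb)
  obtain ⟨c, hc⟩ := Ideal.mem_span_singleton'.mp
    (huv a (Ideal.mem_span_singleton'.mpr ⟨b, hab.symm⟩))
  refine Ideal.mem_span_singleton'.mpr ⟨c, mul_left_cancel₀ hu0 ?_⟩
  linear_combination f * hc + ha

/-- An associated prime is the annihilator of some class `h`. If it contained `I`, then `I h ⊆ (f)`
would force `h ∈ (f)`, making the annihilator the whole ring. -/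
theorem not_le_of_mem_associatedPrimes {A : Type*} [CommRing A] [IsDomain A] [IsNoetherianRing A]
    {I : Ideal A} (hI : 2 ≤ grade I) {f : A} (hf : f ≠ 0) {P : Ideal A}
    (hP : P ∈ associatedPrimes A (A ⧸ Ideal.span {f})) : ¬ I ≤ P := by
  intro hle
  obtain ⟨hprime, y, hy⟩ := Submodule.isAssociatedPrime_iff.mp hP
  obtain ⟨h, rfl⟩ := Ideal.Quotient.mk_surjective y
  have hmem : ∀ x, x ∈ P ↔ x * h ∈ Ideal.span {f} := fun x => by
    rw [hy, Submodule.mem_colon_singleton, Submodule.mem_bot, ← Ideal.Quotient.eq_zero_iff_mem]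
    rfl
  have hh := mem_span_singleton_of_forall_mul_mem hI hf fun x hx => (hmem x).mp (hle hx)
  exact hprime.ne_top ((Ideal.eq_top_iff_one P).mpr ((hmem 1).mpr (by rwa [one_mul])))

theorem mul_mem_imp_of_forall_notMem_associatedPrimes {A : Type*} [CommRing A]
    [IsNoetherianRing A] {I : Ideal A} {g : A} (hg : ∀ P ∈ associatedPrimes A (A ⧸ I), g ∉ P)
    {h : A} (hh : g * h ∈ I) : h ∈ I := by
  have hreg : IsSMulRegular (A ⧸ I) g := by
    by_contra hreg
    have hmem : g ∈ {r | IsSMulRegular (A ⧸ I) r}ᶜ := hreg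
    rw [← biUnion_associatedPrimes_eq_compl_regular] at hmem
    obtain ⟨P, hP, hPg⟩ := Set.mem_iUnion₂.mp hmem
    exact hg P hP hPg
  exact (isSMulRegular_quotient_iff_mem_of_smul_mem _ _).mp hreg h hh

variable {k : Type*} [Field k] {n d : ℕ} (𝔭 : Ideal (MvPolynomial (Fin (n + 1)) k))

theorem mk_mem_irrelevantIdeal (hd : 0 < d) {F : MvPolynomial (Fin (n + 1)) k}
    (hF : F.IsHomogeneous d) : Ideal.Quotient.mk 𝔭 F ∈ irrelevantIdeal 𝔭 := by
  have h : F ∈ Ideal.span (X '' (Set.univ : Set (Fin (n + 1)))) := by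
    rw [mem_ideal_span_X_image]
    intro m hm
    by_contra hne
    push Not at hne
    have hm0 : m = 0 := Finsupp.ext fun i => hne i (Set.mem_univ i)
    have hdeg := hF.coeff_eq_zero (d := m) (by simpa [hm0] using hd.ne)
    exact mem_support_iff.mp hm hdeg
  have := Ideal.mem_map_of_mem (Ideal.Quotient.mk 𝔭) h
  rwa [Ideal.map_span, Set.image_univ, ← Set.range_comp] at this

theorem two_le_gradedDepth_of_nonempty_regularLocus [𝔭.IsPrime]
    (h : (regularLocus 𝔭 d).Nonempty) : 2 ≤ gradedDepth 𝔭 := by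
  obtain ⟨x, hx⟩ := h
  rcases Nat.eq_zero_or_pos d with rfl | hd
  · exact (not_isRegularPair_of_degree_zero 𝔭 x.rep hx).elim
  · exact two_le_grade hx (mk_mem_irrelevantIdeal 𝔭 hd (form_isHomogeneous _))
      (mk_mem_irrelevantIdeal 𝔭 hd (form_isHomogeneous _))

theorem exists_form_eq_X_pow (d : ℕ) (i : Fin (n + 1)) :
    ∃ a : Mon n d → k, form a = X i ^ d := by
  classical
  have hmem : Finsupp.single i d ∈ Finset.finsuppAntidiag Finset.univ d := by
    simp [Finset.mem_finsuppAntidiag, Finsupp.single_apply]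
  refine ⟨Pi.single ⟨_, hmem⟩ 1, ?_⟩
  rw [form, Finset.sum_eq_single ⟨_, hmem⟩, Pi.single_eq_same, one_smul, X_pow_eq_monomial]
  · intro m _ hm
    rw [Pi.single_eq_of_ne hm, zero_smul]
  · simp

theorem irrelevantIdeal_le_of_forall_form_mem
    {P : Ideal (MvPolynomial (Fin (n + 1)) k ⧸ 𝔭)} (hP : P.IsPrime)
    (h : ∀ a : Mon n d → k, Ideal.Quotient.mk 𝔭 (form a) ∈ P) : irrelevantIdeal 𝔭 ≤ P := by
  refine Ideal.span_le.mpr ?_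
  rintro _ ⟨i, rfl⟩
  obtain ⟨a, ha⟩ := exists_form_eq_X_pow (k := k) d i
  have := h a
  rw [ha, map_pow] at this
  exact hP.mem_of_pow_mem d this

/-- Prime avoidance by forms of a fixed degree. -/
theorem exists_form_notMem [Infinite k] {S : Set (Ideal (MvPolynomial (Fin (n + 1)) k ⧸ 𝔭))}
    (hS : S.Finite) (hprime : ∀ P ∈ S, P.IsPrime) (hirr : ∀ P ∈ S, ¬ irrelevantIdeal 𝔭 ≤ P)
    (d : ℕ) : ∃ b : Mon n d → k, ∀ P ∈ S, Ideal.Quotient.mk 𝔭 (form b) ∉ P := by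
  classical
  let L : (Mon n d → k) →ₗ[k] MvPolynomial (Fin (n + 1)) k ⧸ 𝔭 :=
    (Ideal.Quotient.mkₐ k 𝔭).toLinearMap ∘ₗ
      Fintype.linearCombination k (fun i : Mon n d => monomial i.1 (1 : k))
  have hL : ∀ a, L a = Ideal.Quotient.mk 𝔭 (form a) := fun a => by
    simp only [L, LinearMap.comp_apply, Fintype.linearCombination_apply]
    rfl
  let W : Ideal (MvPolynomial (Fin (n + 1)) k ⧸ 𝔭) → Subspace k (Mon n d → k) :=
    fun P => (P.restrictScalars k).comap L
  -- Each prime cuts out a proper subspace of coefficient vectors, as it cannot contain every `x_i ^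
  -- d`; a vector space over an infinite field is no finite union of proper subspaces.
  have hW : ⊤ ∉ hS.toFinset.image W := by
    rw [Finset.mem_image]
    rintro ⟨P, hP, hPtop⟩
    rw [Set.Finite.mem_toFinset] at hP
    refine hirr P hP (irrelevantIdeal_le_of_forall_form_mem (d := d) 𝔭 (hprime P hP) fun a => ?_)
    have ha : a ∈ W P := hPtop ▸ Submodule.mem_top
    rw [← hL]
    exact ha
  obtain ⟨b, hb⟩ := (Set.ne_univ_iff_exists_notMem _).mp
    (Subspace.biUnion_ne_univ_of_top_notMem hW)
  refine ⟨b, fun P hP hmem => hb ?_⟩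
  refine Set.mem_iUnion₂.mpr ⟨W P, Finset.mem_image_of_mem W (hS.mem_toFinset.mpr hP), ?_⟩
  change L b ∈ P
  rwa [hL]

theorem nonempty_regularLocus [Infinite k] [𝔭.IsPrime]
    (hhom : 𝔭.IsHomogeneous (homogeneousSubmodule (Fin (n + 1)) k)) (hd : 0 < d)
    (hdepth : 2 ≤ gradedDepth 𝔭) : (regularLocus 𝔭 d).Nonempty := by
  -- If all forms of degree `d` vanished in the domain `R`, the irrelevant ideal would lie in the
  -- prime `⊥` and have no nonzero element.
  obtain ⟨a, ha⟩ : ∃ a : Mon n d → k, Ideal.Quotient.mk 𝔭 (form a) ≠ 0 := by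
    by_contra hall
    push Not at hall
    obtain ⟨u, hu, -, -, hu0, -⟩ := exists_of_two_le_grade hdepth
    exact hu0 (irrelevantIdeal_le_of_forall_form_mem (d := d) 𝔭 Ideal.isPrime_bot
      (fun a => hall a) hu)
  set f := Ideal.Quotient.mk 𝔭 (form a)
  obtain ⟨b, hb⟩ := exists_form_notMem 𝔭
    (associatedPrimes.finite (MvPolynomial (Fin (n + 1)) k ⧸ 𝔭) (_ ⧸ Ideal.span {f}))
    (fun P hP => hP.isPrime) (fun P hP => not_le_of_mem_associatedPrimes hdepth ha hP) d
  have hpair : IsRegularPair 𝔭 (fun x : Fin 2 × Mon n d => if x.1 = 0 then a x.2 else b x.2) := by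
    refine isRegular_pair_iff.mpr ⟨?_, ?_, ?_⟩
    · simpa using ha
    · intro h hh
      exact mul_mem_imp_of_forall_notMem_associatedPrimes hb hh
    · exact span_pair_mk_ne_top hhom hd (form_isHomogeneous _) (form_isHomogeneous _)
  refine ⟨Projectivization.mk k _ ?_, (mk_mem_regularLocus 𝔭 _ ?_).mpr hpair⟩ <;>
  · intro h0
    refine ha ?_
    have ha0 : a = 0 := funext fun i => by simpa using congrFun h0 (0, i)
    simp [f, ha0, form]

end OpenLoci

theorem proposition2 {k : Type*} [Field k] (n d : ℕ)
    (𝔭 : Ideal (MvPolynomial (Fin (n + 1)) k)) (hprime : 𝔭.IsPrime)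
    (hhom : 𝔭.IsHomogeneous (MvPolynomial.homogeneousSubmodule (Fin (n + 1)) k)) :
    OpenLoci.IsZariskiOpen (OpenLoci.regularLocus 𝔭 d) ∧
    ((OpenLoci.regularLocus 𝔭 d).Nonempty → 2 ≤ OpenLoci.gradedDepth 𝔭) ∧
    (Infinite k → 0 < d →
      (2 ≤ OpenLoci.gradedDepth 𝔭 → (OpenLoci.regularLocus 𝔭 d).Nonempty)) :=
  ⟨OpenLoci.isZariskiOpen_regularLocus 𝔭 hhom d,
    OpenLoci.two_le_gradedDepth_of_nonempty_regularLocus 𝔭,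
    fun _ hd => OpenLoci.nonempty_regularLocus 𝔭 hhom hd⟩
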